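/- Let $(X,\mathsf d)$ be a complete separable metric space, let $\mu_0,\mu_1$ be finite nonnegative Borel measures on $X$, let $p>0$, and put $Y:=X\times[0,\infty)$, with points $y_i=(x_i,s_i)\in Y$. Let $c\colon X\times X\to[0,\infty]$ be lower semicontinuous and let $\nu_Y$ be a Borel probability measure on $Y\times Y$. Let $F\colon[0,\infty)\to[0,\infty]$ be an entropy function, i.e. convex, lower semicontinuous and finite at some positive point (for example $F(s)=s\log s-s+1$). Put $F'_\infty:=\lim_{s\to\infty}F(s)/s$, $R(s):=sF(1/s)$ for $s>0$, and $R(0):=F'_\infty$. The induced marginal perspective cost is the function $H\colon Y\times Y\to[0,\infty]$ such that, if $c(x_0,x_1)<\infty$, then $(s_0,s_1)\mapsto H(x_0,s_0,x_1,s_1)$ is the lower semicontinuous envelope on $[0,\infty)^2$ of $$(s_0,s_1)\mapsto\inf_{t>0}\ t\Big(R\big(\tfrac{s_0}{t}\big)+R\big(\tfrac{s_1}{t}\big)+c(x_0,x_1)\Big),$$ and, if $c(x_0,x_1)=\infty$, then $H(x_0,s_0,x_1,s_1)=F(0)s_0+F(0)s_1$, with $\infty\cdot 0=0$. Put $H_p(y_0,y_1):=H(x_0,s_0^p,x_1,s_1^p)$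 and $(H_p,\alpha):=\int_{Y\times Y}H_p\,d\alpha$. For probability measures $\alpha$ on $Y\times Y$ let $\mathcal F(\alpha\mid\nu_Y)\in[0,\infty]$ be the Kullback–Leibler divergence (relative entropy) of $\alpha$ with respect to $\nu_Y$. Let $\mathsf h^p\beta:=\pi^{x}_{\#}(s^p\beta)$ for $\beta\in\mathcal P(Y)$, let $\mathsf h^p_i\alpha:=\pi^{x_i}_{\#}(s_i^p\alpha)$ for $\alpha\in\mathcal P(Y\times Y)$, $i=0,1$, put $s_*:=(\mu_0(X)+\mu_1(X))^{1/p}$ and $Y[s_*]:=\{(x,s)\in Y: s\le s_*\}$, and define $$\overline S^p_=(\mu_0,\mu_1):=\{\alpha\in\mathcal P(Y\times Y):\ \mathsf h_i^p\alpha=\mu_i\ (i=0,1),\ \alpha\big((Y\times Y)\setminus(Y[s_*]\times Y[s_*])\big)=0\},$$ $$\overline S^p_=(\mu_i):=\{\beta\in\mathcal P(Y):\ \mathsf h^p\beta=\mu_i,\ \beta(Y\setminus Y[s_*])=0\}.$$ For $\varepsilon>0$ let $$\mathrm{UOT}_{Y,\varepsilon}(\mu_0,\mu_1):=\inf_{\alpha\in\overline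 S^p_=(\mu_0,\mu_1)}\big\{(H_p,\alpha)+\varepsilon\,\mathcal F(\alpha\mid\nu_Y)\big\},\qquad \mathrm{OT}_\varepsilon(\beta_0,\beta_1):=\inf_{\alpha}\big\{(H_p,\alpha)+\varepsilon\,\mathcal F(\alpha\mid\nu_Y)\big\},$$ where the second infimum is over all $\alpha\in\mathcal P(Y\times Y)$ with marginals $\beta_0,\beta_1\in\mathcal P(Y)$. Both infima take values in $[0,\infty]$. Then for every $\varepsilon>0$ there exists $\overline\alpha^\varepsilon\in\overline S^p_=(\mu_0,\mu_1)$ such that $$\mathrm{UOT}_{Y,\varepsilon}(\mu_0,\mu_1)=(H_p,\overline\alpha^\varepsilon)+\varepsilon\,\mathcal F(\overline\alpha^\varepsilon\mid\nu_Y)=\mathrm{OT}_\varepsilon(\overline\alpha^\varepsilon_0,\overline\alpha^\varepsilon_1),$$ where $\overline\alpha^\varepsilon_i:=\pi^i_{\#}\overline\alpha^\varepsilon\in\overline S^p_=(\mu_i)$ is the $i$th marginal, $i=0,1$. -/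

import Mathlib

open MeasureTheory Filter Topology
open scoped NNReal ENNReal

noncomputable section

namespace EUOT

/-- Entropy functions: convex, lower semicontinuous functions `F : [0,∞) → [0,∞]` that are finite
at some positive point. -/
structure IsEntropyFunction (F : ℝ≥0 → ℝ≥0∞) : Prop where
  convex : ConvexOn ℝ≥0 Set.univ F
  lsc : LowerSemicontinuous F
  proper : ∃ s : ℝ≥0, 0 < s ∧ F s ≠ ∞

/-- The recession constant `F'_∞ = lim_{s → ∞} F(s)/s`; for an entropy function the limit exists
in `[0,∞]`, so it is equal to the lower limit. -/
def recession (F : ℝ≥0 → ℝ≥0∞) : ℝ≥0∞ :=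
  liminf (fun s : ℝ≥0 => F s / (s : ℝ≥0∞)) atTop

/-- The reverse entropy: `R(s) = s F(1/s)` for `s > 0` and `R(0) = F'_∞`. -/
def reverseEntropy (F : ℝ≥0 → ℝ≥0∞) (s : ℝ≥0) : ℝ≥0∞ :=
  if s = 0 then recession F else (s : ℝ≥0∞) * F s⁻¹

/-- `inf_{t > 0} t (R(s₀/t) + R(s₁/t) + c)`. -/
def perspectiveInf (F : ℝ≥0 → ℝ≥0∞) (c : ℝ≥0∞) (s₀ s₁ : ℝ≥0) : ℝ≥0∞ :=
  ⨅ (t : ℝ≥0) (_ : 0 < t),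
    (t : ℝ≥0∞) * (reverseEntropy F (s₀ / t) + reverseEntropy F (s₁ / t) + c)

/-- The marginal perspective function. For `c < ∞` it is the lower semicontinuous envelope in
`(s₀, s₁)` of `inf_{t > 0} t (R(s₀/t) + R(s₁/t) + c)`: the lower limit is along the full
neighbourhood filter, the point itself included. For `c = ∞` it is `F(0) s₀ + F(0) s₁`, with
`∞ · 0 = 0`. -/
def perspective (F : ℝ≥0 → ℝ≥0∞) (c : ℝ≥0∞) (s₀ s₁ : ℝ≥0) : ℝ≥0∞ :=
  if c = ∞ then F 0 * (s₀ : ℝ≥0∞) + F 0 * (s₁ : ℝ≥0∞)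
  else liminf (fun q : ℝ≥0 × ℝ≥0 => perspectiveInf F c q.1 q.2) (𝓝 (s₀, s₁))

variable {X : Type*}

/-- The extended space `Y = X × ℝ₊`. -/
abbrev Ext (X : Type*) : Type _ := X × ℝ≥0

/-- The induced marginal perspective cost `H(x₀,s₀,x₁,s₁)`. -/
def H (F : ℝ≥0 → ℝ≥0∞) (c : X × X → ℝ≥0∞) (x₀ : X) (s₀ : ℝ≥0) (x₁ : X) (s₁ : ℝ≥0) : ℝ≥0∞ :=
  perspective F (c (x₀, x₁)) s₀ s₁

/-- `H_p(y₀,y₁) = H(x₀,s₀^p,x₁,s₁^p)`. -/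
def Hp (F : ℝ≥0 → ℝ≥0∞) (c : X × X → ℝ≥0∞) (p : ℝ) (y : Ext X × Ext X) : ℝ≥0∞ :=
  H F c y.1.1 (y.1.2 ^ p) y.2.1 (y.2.2 ^ p)

variable [MeasurableSpace X]

/-- The homogeneous marginal `𝗁^p β = π^x_#(s^p β)` of a measure on `Y`. -/
def homMarginal (p : ℝ) (β : Measure (Ext X)) : Measure X :=
  (β.withDensity (fun y => ((y.2 ^ p : ℝ≥0) : ℝ≥0∞))).map (fun y => y.1)

/-- `𝗁₀^p α = π^{x₀}_#(s₀^p α)`. -/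
def homMarginal₀ (p : ℝ) (α : Measure (Ext X × Ext X)) : Measure X :=
  (α.withDensity (fun y => ((y.1.2 ^ p : ℝ≥0) : ℝ≥0∞))).map (fun y => y.1.1)

/-- `𝗁₁^p α = π^{x₁}_#(s₁^p α)`. -/
def homMarginal₁ (p : ℝ) (α : Measure (Ext X × Ext X)) : Measure X :=
  (α.withDensity (fun y => ((y.2.2 ^ p : ℝ≥0) : ℝ≥0∞))).map (fun y => y.2.1)

/-- `s_* = (μ₀(X) + μ₁(X))^{1/p}`. -/
def sStar (p : ℝ) (μ₀ μ₁ : Measure X) : ℝ≥0 :=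
  ((μ₀ Set.univ).toNNReal + (μ₁ Set.univ).toNNReal) ^ (1 / p)

/-- `Y[r] = {(x,s) ∈ Y : s ≤ r}`. -/
def extBall (X : Type*) (r : ℝ≥0) : Set (Ext X) := {y | y.2 ≤ r}

/-- The rescaled constraint set on `Y × Y`: probability measures with homogeneous marginals
`μ₀, μ₁` that do not charge the complement of `Y[s_*] × Y[s_*]`. -/
def constraintSet (p : ℝ) (μ₀ μ₁ : Measure X) : Set (Measure (Ext X × Ext X)) :=
  {α | IsProbabilityMeasure α ∧ homMarginal₀ p α = μ₀ ∧ homMarginal₁ p α = μ₁ ∧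
    α (extBall X (sStar p μ₀ μ₁) ×ˢ extBall X (sStar p μ₀ μ₁))ᶜ = 0}

/-- The rescaled constraint set on `Y` for one measure `μ` and radius bound `r`: probability
measures with homogeneous marginal `μ` that do not charge the complement of `Y[r]`. -/
def constraintSetOne (p : ℝ) (r : ℝ≥0) (μ : Measure X) : Set (Measure (Ext X)) :=
  {β | IsProbabilityMeasure β ∧ homMarginal p β = μ ∧ β (extBall X r)ᶜ = 0}

/-- `Γ(β₀,β₁)`: the couplings of `β₀` and `β₁`. -/
def couplings (β₀ β₁ : Measure (Ext X)) : Set (Measure (Ext X × Ext X)) :=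
  {α | IsProbabilityMeasure α ∧ α.map Prod.fst = β₀ ∧ α.map Prod.snd = β₁}

/-- The regularised functional `(H_p, α) + ε 𝓕(α | ν)`, with `𝓕` the Kullback–Leibler
divergence. -/
def energy (F : ℝ≥0 → ℝ≥0∞) (c : X × X → ℝ≥0∞) (p ε : ℝ) (ν α : Measure (Ext X × Ext X)) :
    ℝ≥0∞ :=
  (∫⁻ y, Hp F c p y ∂α) + ENNReal.ofReal ε * InformationTheory.klDiv α ν

/-- The extended-space regularised problem `UOT_{Y,ε}(μ₀,μ₁)`. -/
def UOTY (F : ℝ≥0 → ℝ≥0∞) (c : X × X → ℝ≥0∞) (p ε : ℝ) (ν : Measure (Ext X × Ext X))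
    (μ₀ μ₁ : Measure X) : ℝ≥0∞ :=
  ⨅ α ∈ constraintSet p μ₀ μ₁, energy F c p ε ν α

/-- The regularised optimal transport problem `OT_ε(β₀,β₁)` on `Y`. -/
def OTeps (F : ℝ≥0 → ℝ≥0∞) (c : X × X → ℝ≥0∞) (p ε : ℝ) (ν : Measure (Ext X × Ext X))
    (β₀ β₁ : Measure (Ext X)) : ℝ≥0∞ :=
  ⨅ α ∈ couplings β₀ β₁, energy F c p ε ν α

end EUOT

end

namespace EUOT

open InformationTheory

/-! The direct method works here in the strong L¹ topology of densities with respect to the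
reference measure. Relative entropy is uniformly convex at midpoints: its convexity gap controls the
L¹ distance of the densities (`two_mul_klDiv_midpoint_add_le`), while the transport cost is linear
in the measure. Since the constraint set is midpoint convex, a minimising sequence is therefore
Cauchy in L¹. The constraints prescribe integrals of bounded functions, so they survive the limit,
and Fatou's lemma gives lower semicontinuity (`exists_forall_entropicEnergy_le`). The identity with
the transport problem follows because the constraints see only the two marginals
(`mem_constraintSet_iff`): every coupling of the minimiser's marginals is a competitor. -/

lemma mul_log_lower_bound {a m : ℝ} (ha : 0 ≤ a) (hm : 0 < m) :
    a * Real.log m + 2 * a - 2 * (√a * √m) ≤ a * Real.log a := by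
  rcases ha.eq_or_lt with rfl | ha
  · simp
  have hx : 0 < √a := Real.sqrt_pos.2 ha
  have hy : 0 < √m := Real.sqrt_pos.2 hm
  -- Applying `log u ≤ u - 1` to `u = √m / √a`, rather than to `m / a`, yields a Hellinger-type
  -- bound.
  have h := Real.log_le_sub_one_of_pos (div_pos hy hx)
  rw [Real.log_div hy.ne' hx.ne', Real.log_sqrt hm.le, Real.log_sqrt ha.le] at h
  have h2 : a * (√m / √a) = √a * √m := by
    nth_rewrite 1 [← Real.mul_self_sqrt ha.le]
    field_simp
  nlinarith [mul_le_mul_of_nonneg_left h ha.le]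

/-- Quantitative midpoint convexity of `klFun`, controlling the distance `|a - b|`. -/
lemma two_mul_klFun_midpoint_add_le {a b : ℝ} (ha : 0 ≤ a) (hb : 0 ≤ b) (t : ℝ) :
    2 * klFun ((a + b) / 2) + t * |a - b| ≤ klFun a + klFun b + t ^ 2 * (a + b) := by
  rcases (add_nonneg ha hb).eq_or_lt with h0 | h0
  · have ha0 : a = 0 := by linarith
    have hb0 : b = 0 := by linarith
    subst ha0 hb0
    norm_num [two_mul]
  have hm : 0 < (a + b) / 2 := by linarith
  have h1 := mul_log_lower_bound ha hm
  have h2 := mul_log_lower_bound hb hm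
  set m := (a + b) / 2 with hmdef
  have hxa := Real.mul_self_sqrt ha
  have hyb := Real.mul_self_sqrt hb
  have hzm := Real.mul_self_sqrt hm.le
  have hx := Real.sqrt_nonneg a
  have hy := Real.sqrt_nonneg b
  set x := √a
  set y := √b
  set z := √m
  have hd : |a - b| = |x - y| * (x + y) := by
    rw [← hxa, ← hyb, mul_self_sub_mul_self, abs_mul, abs_of_nonneg (add_nonneg hx hy), mul_comm]
  have hsq : |x - y| ^ 2 = (x - y) ^ 2 := sq_abs _
  have hab : a + b = 2 * m := by rw [hmdef]; ring
  have hlog : a * Real.log m + b * Real.log m = 2 * (m * Real.log m) := by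
    rw [← add_mul, hab]; ring
  -- Young's inequality with weight `t` keeps `|a - b|` linear, so integration gives an L¹ norm
  -- directly.
  have h3 : t * (|x - y| * (x + y)) ≤ (x - y) ^ 2 / 2 + t ^ 2 * (a + b) := by
    nlinarith [sq_nonneg (|x - y| - t * (x + y)), mul_nonneg (sq_nonneg t) (sq_nonneg (x - y))]
  -- The right side is what `h1` and `h2` leave as a lower bound for the convexity gap.
  have h4 : (x - y) ^ 2 / 2 ≤ 2 * (a + b) - 2 * z * (x + y) := by
    nlinarith [sq_nonneg (2 * z - (x + y))]
  rw [hd]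
  simp only [klFun_apply]
  nlinarith

/-! ### Minimisation of linear cost plus relative entropy -/

section Entropic

variable {Ω : Type*} [MeasurableSpace Ω]

/-- This is the pointwise inequality integrated against `ν`; the error `t² (a + b)` becomes `2 t²`
because both densities have mass one. -/
lemma two_mul_klDiv_midpoint_add_le {ν α β : Measure Ω} [IsProbabilityMeasure ν]
    [IsProbabilityMeasure α] [IsProbabilityMeasure β] (hα : α ≪ ν) (hβ : β ≪ ν) {t : ℝ}
    (ht : 0 ≤ t) :
    2 * klDiv ((2⁻¹ : ℝ≥0∞) • (α + β)) ν + ENNReal.ofReal t *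
        eLpNorm (fun x => (α.rnDeriv ν x).toReal - (β.rnDeriv ν x).toReal) 1 ν
      ≤ klDiv α ν + klDiv β ν + ENNReal.ofReal (2 * t ^ 2) := by
  have hγ : (2⁻¹ : ℝ≥0∞) • (α + β) ≪ ν := (Measure.AbsolutelyContinuous.add_left hα hβ).smul_left _
  have : IsFiniteMeasure ((2⁻¹ : ℝ≥0∞) • (α + β)) := Measure.smul_finite _ (by simp)
  rw [klDiv_eq_lintegral_klFun_of_ac hγ, klDiv_eq_lintegral_klFun_of_ac hα,
    klDiv_eq_lintegral_klFun_of_ac hβ, eLpNorm_one_eq_lintegral_enorm]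
  have hα1 : ∫⁻ x, α.rnDeriv ν x ∂ν = 1 := by rw [Measure.lintegral_rnDeriv hα, measure_univ]
  have hβ1 : ∫⁻ x, β.rnDeriv ν x ∂ν = 1 := by rw [Measure.lintegral_rnDeriv hβ, measure_univ]
  have h2 : ENNReal.ofReal (2 * t ^ 2) =
      ∫⁻ x, ENNReal.ofReal (t ^ 2) * (α.rnDeriv ν x + β.rnDeriv ν x) ∂ν := by
    rw [lintegral_const_mul _ (by fun_prop), lintegral_add_left (by fun_prop), hα1, hβ1,
      mul_comm 2, ENNReal.ofReal_mul (by positivity)]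
    norm_num [one_add_one_eq_two]
  have hm : ∀ μ : Measure Ω, Measurable fun x => ENNReal.ofReal (klFun (μ.rnDeriv ν x).toReal) :=
    fun μ => (measurable_klFun.comp (Measure.measurable_rnDeriv _ _).ennreal_toReal).ennreal_ofReal
  have hme : Measurable fun x => ‖(α.rnDeriv ν x).toReal - (β.rnDeriv ν x).toReal‖ₑ := by fun_prop
  have hms : Measurable fun x =>
      ENNReal.ofReal (t ^ 2) * (α.rnDeriv ν x + β.rnDeriv ν x) := by fun_prop
  rw [h2, ← lintegral_const_mul _ (hm _), ← lintegral_const_mul _ hme,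
    ← lintegral_add_left ((hm _).const_mul _), ← lintegral_add_left (hm _),
    ← lintegral_add_right _ hms]
  refine lintegral_mono_ae ?_
  filter_upwards [Measure.rnDeriv_smul_left_of_ne_top (α + β) ν (r := 2⁻¹) (by simp),
    Measure.rnDeriv_add α β ν, Measure.rnDeriv_ne_top α ν, Measure.rnDeriv_ne_top β ν]
    with x h1 h2 h3 h4
  rw [h1, Pi.smul_apply, h2, Pi.add_apply]
  lift α.rnDeriv ν x to ℝ≥0 using h3 with a
  lift β.rnDeriv ν x to ℝ≥0 using h4 with b
  have ha := a.coe_nonneg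
  have hb := b.coe_nonneg
  have key := two_mul_klFun_midpoint_add_le ha hb t
  have hmid : ((2⁻¹ : ℝ≥0∞) • ((a : ℝ≥0∞) + b)).toReal = ((a : ℝ) + b) / 2 := by
    simp [ENNReal.toReal_mul, ENNReal.toReal_add]
    ring
  have hk : ∀ r : ℝ, 0 ≤ r → 0 ≤ klFun r := fun r => klFun_nonneg
  rw [hmid, ENNReal.coe_toReal, ENNReal.coe_toReal, Real.enorm_eq_ofReal_abs,
    ← ENNReal.ofReal_mul ht, ← ENNReal.ofReal_coe_nnreal (p := a),
    ← ENNReal.ofReal_coe_nnreal (p := b), ← ENNReal.ofReal_add ha hb,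
    ← ENNReal.ofReal_mul (by positivity), ← ENNReal.ofReal_add (hk _ ha) (hk _ hb),
    ← ENNReal.ofReal_add (add_nonneg (hk _ ha) (hk _ hb)) (by positivity),
    show (2 : ℝ≥0∞) = ENNReal.ofReal 2 by simp, ← ENNReal.ofReal_mul (by norm_num),
    ← ENNReal.ofReal_add (mul_nonneg (by norm_num) (hk _ (by positivity))) (by positivity)]
  exact ENNReal.ofReal_le_ofReal key

/-- If the real densities `f n` converge to `g` in `L¹`, integrals of a bounded function that are
constant along the sequence pass to the limit. -/
lemma lintegral_withDensity_eq_of_tendsto_eLpNorm {ν : Measure Ω} {f : ℕ → Ω → ℝ} {g : Ω → ℝ}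
    (hf : ∀ n, Measurable (f n)) (hg : Measurable g)
    (h : Tendsto (fun n => eLpNorm (f n - g) 1 ν) atTop (𝓝 0))
    {φ : Ω → ℝ≥0∞} (hφ : Measurable φ) {M v : ℝ≥0∞} (hM : M ≠ ∞) (hφM : ∀ x, φ x ≤ M)
    (hv : ∀ n, ∫⁻ x, φ x ∂(ν.withDensity fun x => ENNReal.ofReal (f n x)) = v) :
    ∫⁻ x, φ x ∂(ν.withDensity fun x => ENNReal.ofReal (g x)) = v := by
  -- A one-sided estimate, used with the two densities in either order; it avoids subtraction in
  -- `ℝ≥0∞`.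
  have key : ∀ u w : Ω → ℝ, Measurable u → Measurable w →
      ∫⁻ x, φ x ∂(ν.withDensity fun x => ENNReal.ofReal (u x)) ≤
      ∫⁻ x, φ x ∂(ν.withDensity fun x => ENNReal.ofReal (w x)) + M * eLpNorm (w - u) 1 ν := by
    intro u w hu hw
    rw [lintegral_withDensity_eq_lintegral_mul _ (by fun_prop) hφ,
      lintegral_withDensity_eq_lintegral_mul _ (by fun_prop) hφ, eLpNorm_one_eq_lintegral_enorm,
      ← lintegral_const_mul' _ _ hM, ← lintegral_add_left (by fun_prop)]
    refine lintegral_mono fun x => ?_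
    simp only [Pi.mul_apply, Pi.sub_apply]
    have h1 : ENNReal.ofReal (u x) ≤ ENNReal.ofReal (w x) + ‖w x - u x‖ₑ := by
      rw [Real.enorm_eq_ofReal_abs, abs_sub_comm]
      refine (ENNReal.ofReal_le_ofReal ?_).trans ENNReal.ofReal_add_le
      linarith [le_abs_self (u x - w x)]
    calc _ ≤ (ENNReal.ofReal (w x) + ‖w x - u x‖ₑ) * φ x := by gcongr
      _ ≤ _ := by
        rw [add_mul, mul_comm ‖w x - u x‖ₑ]
        gcongr
        exact hφM x
  have h0 : Tendsto (fun n => M * eLpNorm (f n - g) 1 ν) atTop (𝓝 0) := by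
    simpa using ENNReal.Tendsto.const_mul h (Or.inr hM)
  apply le_antisymm
  · refine ge_of_tendsto' (by simpa using h0.const_add v) fun n => ?_
    rw [← hv n]
    exact key _ _ hg (hf n)
  · have h1 := h0.const_add (∫⁻ x, φ x ∂(ν.withDensity fun x => ENNReal.ofReal (g x)))
    refine ge_of_tendsto' (by simpa using h1) fun n => ?_
    rw [← hv n, eLpNorm_sub_comm]
    exact key _ _ (hf n) hg

/-- The functional `α ↦ (G, α) + ε KL(α | ν)`. -/
noncomputable def entropicEnergy (G : Ω → ℝ≥0∞) (ε : ℝ) (ν α : Measure Ω) : ℝ≥0∞ :=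
  (∫⁻ y, G y ∂α) + ENNReal.ofReal ε * klDiv α ν

/-- The cost term is exactly affine at midpoints, so the entropy supplies the whole convexity gap.
-/
lemma two_mul_entropicEnergy_midpoint_add_le (G : Ω → ℝ≥0∞) {ε : ℝ} (hε : 0 ≤ ε)
    {ν α β : Measure Ω} [IsProbabilityMeasure ν]
    [IsProbabilityMeasure α] [IsProbabilityMeasure β] (hα : α ≪ ν) (hβ : β ≪ ν) {t : ℝ}
    (ht : 0 ≤ t) :
    2 * entropicEnergy G ε ν ((2⁻¹ : ℝ≥0∞) • (α + β)) + ENNReal.ofReal (ε * t) *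
        eLpNorm (fun x => (α.rnDeriv ν x).toReal - (β.rnDeriv ν x).toReal) 1 ν
      ≤ entropicEnergy G ε ν α + entropicEnergy G ε ν β + ENNReal.ofReal (2 * (ε * t ^ 2)) := by
  have h := mul_le_mul_right (two_mul_klDiv_midpoint_add_le hα hβ ht) (ENNReal.ofReal ε)
  unfold entropicEnergy
  rw [lintegral_smul_measure, lintegral_add_measure, smul_eq_mul, mul_add, ← mul_assoc,
    ENNReal.mul_inv_cancel (by simp) (by simp), one_mul, ENNReal.ofReal_mul hε,
    show 2 * (ε * t ^ 2) = ε * (2 * t ^ 2) by ring, ENNReal.ofReal_mul hε]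
  rw [mul_add, mul_add, mul_add] at h
  calc _ = (∫⁻ y, G y ∂α + ∫⁻ y, G y ∂β) + (ENNReal.ofReal ε *
        (2 * klDiv ((2⁻¹ : ℝ≥0∞) • (α + β)) ν) + ENNReal.ofReal ε * (ENNReal.ofReal t *
        eLpNorm (fun x => (α.rnDeriv ν x).toReal - (β.rnDeriv ν x).toReal) 1 ν)) := by ring
    _ ≤ _ := add_le_add_right h _
    _ = _ := by ring

/-- Fatou's lemma for the functional along densities converging almost everywhere; the cost need
not be measurable. -/
lemma entropicEnergy_le_of_tendsto_ae (G : Ω → ℝ≥0∞) (ε : ℝ) {ν : Measure Ω}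
    [IsProbabilityMeasure ν] {α : ℕ → Measure Ω} [∀ n, IsProbabilityMeasure (α n)]
    (hα : ∀ n, α n ≪ ν) {g : Ω → ℝ} (hg : Measurable g)
    [IsFiniteMeasure (ν.withDensity fun x => ENNReal.ofReal (g x))]
    (h : ∀ᵐ x ∂ν, Tendsto (fun n => ((α n).rnDeriv ν x).toReal) atTop (𝓝 (g x)))
    {I : ℝ≥0∞} (hI : liminf (fun n => entropicEnergy G ε ν (α n)) atTop ≤ I) :
    entropicEnergy G ε ν (ν.withDensity fun x => ENNReal.ofReal (g x)) ≤ I := by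
  refine le_trans ?_ hI
  set β := ν.withDensity fun x => ENNReal.ofReal (g x) with hβdef
  have hβ : β ≪ ν := withDensity_absolutelyContinuous _ _
  -- A measurable minorant with the same integral against the limit makes Fatou applicable and only
  -- lowers the energies along the sequence.
  obtain ⟨G', hG'm, hG'le, hG'⟩ := exists_measurable_le_lintegral_eq (μ := β) G
  have hm : ∀ μ : Measure Ω, Measurable fun x => ENNReal.ofReal (klFun (μ.rnDeriv ν x).toReal) :=
    fun μ => (measurable_klFun.comp (Measure.measurable_rnDeriv _ _).ennreal_toReal).ennreal_ofReal
  have repr : ∀ μ : Measure Ω, IsFiniteMeasure μ → μ ≪ ν →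
      (∫⁻ y, G' y ∂μ) + ENNReal.ofReal ε * klDiv μ ν = ∫⁻ x, (μ.rnDeriv ν x * G' x +
        ENNReal.ofReal ε * ENNReal.ofReal (klFun (μ.rnDeriv ν x).toReal)) ∂ν := by
    intro μ _ hμ
    rw [klDiv_eq_lintegral_klFun_of_ac hμ, lintegral_add_left (by fun_prop),
      lintegral_const_mul _ (hm μ), lintegral_rnDeriv_mul hμ hG'm.aemeasurable]
  calc entropicEnergy G ε ν β = (∫⁻ y, G' y ∂β) + ENNReal.ofReal ε * klDiv β ν := by
        rw [entropicEnergy, hG']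
    _ = _ := repr β inferInstance hβ
    _ ≤ ∫⁻ x, liminf (fun n => (α n).rnDeriv ν x * G' x +
          ENNReal.ofReal ε * ENNReal.ofReal (klFun ((α n).rnDeriv ν x).toReal)) atTop ∂ν := by
        refine lintegral_mono_ae ?_
        filter_upwards [h, Measure.rnDeriv_withDensity ν hg.ennreal_ofReal,
          ae_all_iff.2 fun n => Measure.rnDeriv_ne_top (α n) ν] with x hx hgx hfin
        have hx0 : 0 ≤ g x := ge_of_tendsto' hx fun n => ENNReal.toReal_nonneg
        have h1 : Tendsto (fun n => (α n).rnDeriv ν x) atTop (𝓝 (ENNReal.ofReal (g x))) := by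
          simpa [ENNReal.ofReal_toReal (hfin _)] using ENNReal.tendsto_ofReal hx
        have h2 : Tendsto (fun n => ENNReal.ofReal ε *
            ENNReal.ofReal (klFun ((α n).rnDeriv ν x).toReal)) atTop
            (𝓝 (ENNReal.ofReal ε * ENNReal.ofReal (klFun (g x)))) :=
          ENNReal.Tendsto.const_mul (ENNReal.tendsto_ofReal
            ((continuous_klFun.tendsto _).comp hx)) (Or.inr ENNReal.ofReal_ne_top)
        rw [hβdef, hgx, ENNReal.toReal_ofReal hx0]
        -- Where the limit density vanishes, `G' x` may be infinite and the product discontinuous;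
        -- the cost term is then zero in the limit and can be dropped.
        rcases eq_or_ne (ENNReal.ofReal (g x)) 0 with h0 | h0
        · rw [h0, zero_mul, zero_add, ← h2.liminf_eq]
          exact liminf_le_liminf (Eventually.of_forall fun n => le_add_self)
        · exact ((ENNReal.Tendsto.mul_const h1 (Or.inl h0)).add h2).liminf_eq.ge
    _ ≤ liminf (fun n => ∫⁻ x, ((α n).rnDeriv ν x * G' x +
          ENNReal.ofReal ε * ENNReal.ofReal (klFun ((α n).rnDeriv ν x).toReal)) ∂ν) atTop :=
        lintegral_liminf_le fun n =>
          ((Measure.measurable_rnDeriv _ _).mul hG'm).add ((hm _).const_mul _)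
    _ ≤ _ := by
        refine liminf_le_liminf (Eventually.of_forall fun n => ?_)
        rw [← repr (α n) inferInstance (hα n), entropicEnergy]
        gcongr
        exact hG'le _

/-- A midpoint convex set of probability measures which is closed under strong convergence of
densities contains a minimiser of the entropic functional. -/
theorem exists_forall_entropicEnergy_le (G : Ω → ℝ≥0∞) {ε : ℝ} (hε : 0 < ε) (ν : Measure Ω)
    [IsProbabilityMeasure ν] {S : Set (Measure Ω)} (hne : S.Nonempty)
    (hprob : ∀ α ∈ S, IsProbabilityMeasure α)
    (hconv : ∀ α ∈ S, ∀ β ∈ S, (2⁻¹ : ℝ≥0∞) • (α + β) ∈ S)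
    (hclosed : ∀ (α : ℕ → Measure Ω) (β : Measure Ω), (∀ n, α n ∈ S) →
      (∀ φ : Ω → ℝ≥0∞, Measurable φ → ∀ M : ℝ≥0∞, M ≠ ∞ → (∀ x, φ x ≤ M) → ∀ v : ℝ≥0∞,
        (∀ n, ∫⁻ x, φ x ∂(α n) = v) → ∫⁻ x, φ x ∂β = v) → β ∈ S) :
    ∃ α ∈ S, ∀ β ∈ S, entropicEnergy G ε ν α ≤ entropicEnergy G ε ν β := by
  set I := ⨅ α ∈ S, entropicEnergy G ε ν α with hIdef
  have hIle : ∀ β ∈ S, I ≤ entropicEnergy G ε ν β := fun β hβ => iInf₂_le β hβ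
  suffices h : ∃ α ∈ S, entropicEnergy G ε ν α ≤ I by
    obtain ⟨α, hα, h⟩ := h
    exact ⟨α, hα, fun β hβ => h.trans (hIle β hβ)⟩
  rcases eq_or_ne I ∞ with hI | hI
  · obtain ⟨α, hα⟩ := hne
    exact ⟨α, hα, hI ▸ le_top⟩
  -- With excess `ε t²`, two near-minimisers contribute `2 ε t²` and the midpoint inequality another
  -- `2 ε t²`. Dividing by `ε t` bounds their L¹ distance by `4 t`; the factor 5 below makes this
  -- strict, and geometric decay makes it summable.
  set t : ℕ → ℝ := fun n => (1 / 2) ^ n with ht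
  have htpos : ∀ n, 0 < t n := fun n => by positivity
  have htanti : ∀ {m n}, m ≤ n → t n ≤ t m := fun h =>
    pow_le_pow_of_le_one (by norm_num) (by norm_num) h
  have hex : ∀ n, ∃ α ∈ S, entropicEnergy G ε ν α < I + ENNReal.ofReal (ε * t n ^ 2) := fun n => by
    have : I < I + ENNReal.ofReal (ε * t n ^ 2) :=
      ENNReal.lt_add_right hI (by simpa using mul_pos hε (pow_pos (htpos n) 2))
    simpa [hIdef, iInf_lt_iff] using this
  choose α hαS hαI using hex
  have : ∀ n, IsProbabilityMeasure (α n) := fun n => hprob _ (hαS n)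
  -- Finite energy and `ε > 0` force finite entropy.
  have hac : ∀ n, α n ≪ ν := fun n => by
    have h1 : ENNReal.ofReal ε * klDiv (α n) ν ≠ ∞ :=
      ((le_add_self.trans_lt (hαI n)).trans_le le_top).ne
    by_contra hn
    rw [klDiv_of_not_ac hn, ENNReal.mul_top (by simpa using hε)] at h1
    exact h1 rfl
  set f : ℕ → Ω → ℝ := fun n x => ((α n).rnDeriv ν x).toReal with hf
  have hfm : ∀ n, Measurable (f n) := fun n => by fun_prop
  have hdens : ∀ n, (ν.withDensity fun x => ENNReal.ofReal (f n x)) = α n := fun n => by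
    refine (withDensity_congr_ae ?_).trans (Measure.withDensity_rnDeriv_eq _ _ (hac n))
    filter_upwards [Measure.rnDeriv_ne_top (α n) ν] with x hx
    exact ENNReal.ofReal_toReal hx
  have hcau : ∀ N n m : ℕ, N ≤ n → N ≤ m → eLpNorm (f n - f m) 1 ν < ENNReal.ofReal (5 * t N) := by
    intro N n m hn hm
    have h1 := two_mul_entropicEnergy_midpoint_add_le G hε.le (hac n) (hac m) (htpos N).le
    have hmono : ∀ k, N ≤ k → entropicEnergy G ε ν (α k) ≤ I + ENNReal.ofReal (ε * t N ^ 2) := by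
      intro k hk
      refine (hαI k).le.trans ?_
      have := htanti hk
      have := (htpos k).le
      gcongr
    have h2 : 2 * I + ENNReal.ofReal (ε * t N) * eLpNorm (f n - f m) 1 ν ≤
        2 * I + ENNReal.ofReal (ε * t N) * ENNReal.ofReal (4 * t N) := by
      calc _ ≤ _ := add_le_add_left
            (mul_le_mul_right (hIle _ (hconv _ (hαS n) _ (hαS m))) 2) _
        _ ≤ _ := h1
        _ ≤ (I + ENNReal.ofReal (ε * t N ^ 2)) + (I + ENNReal.ofReal (ε * t N ^ 2)) +
            ENNReal.ofReal (2 * (ε * t N ^ 2)) :=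
          add_le_add_left (add_le_add (hmono n hn) (hmono m hm)) _
        _ = 2 * I + (ENNReal.ofReal (ε * t N ^ 2) + ENNReal.ofReal (ε * t N ^ 2) +
            ENNReal.ofReal (2 * (ε * t N ^ 2))) := by ring
        _ = _ := by
          rw [← ENNReal.ofReal_add (by positivity) (by positivity),
            ← ENNReal.ofReal_add (by positivity) (by positivity),
            ← ENNReal.ofReal_mul (by positivity)]
          ring_nf
    have h3 := (ENNReal.add_le_add_iff_left (ENNReal.mul_ne_top (by simp) hI)).1 h2
    have h4 := (ENNReal.mul_le_mul_iff_right
      (by simpa using mul_pos hε (htpos N)) ENNReal.ofReal_ne_top).1 h3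
    refine h4.trans_lt ((ENNReal.ofReal_lt_ofReal_iff (by linarith [htpos N])).2 ?_)
    linarith [htpos N]
  have hsum : ∑' n, ENNReal.ofReal (5 * t n) ≠ ∞ := by
    have hs : Summable fun n => 5 * t n :=
      (summable_geometric_of_lt_one (by norm_num) (by norm_num)).mul_left 5
    exact hs.tsum_ofReal_ne_top
  obtain ⟨g₀, hg₀, hlim₀⟩ := Lp.cauchy_complete_eLpNorm le_rfl
    (fun n => memLp_one_iff_integrable.2 Measure.integrable_toReal_rnDeriv) hsum hcau
  set g := hg₀.1.mk g₀
  have hgm : Measurable g := hg₀.1.measurable_mk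
  have hlim : Tendsto (fun n => eLpNorm (f n - g) 1 ν) atTop (𝓝 0) := by
    refine hlim₀.congr fun n => eLpNorm_congr_ae ?_
    exact EventuallyEq.rfl.sub hg₀.1.ae_eq_mk
  have htest : ∀ φ : Ω → ℝ≥0∞, Measurable φ → ∀ M : ℝ≥0∞, M ≠ ∞ → (∀ x, φ x ≤ M) →
      ∀ v : ℝ≥0∞, (∀ n, ∫⁻ x, φ x ∂(α n) = v) →
      ∫⁻ x, φ x ∂(ν.withDensity fun x => ENNReal.ofReal (g x)) = v :=
    fun φ hφ M hM hφM v hv => lintegral_withDensity_eq_of_tendsto_eLpNorm hfm hgm hlim hφ hM hφM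
      fun n => by rw [hdens n, hv n]
  have hS := hclosed α _ hαS htest
  refine ⟨_, hS, ?_⟩
  have := hprob _ hS
  obtain ⟨ns, hns, hae⟩ := (tendstoInMeasure_of_tendsto_eLpNorm one_ne_zero
    (fun n => (hfm n).aestronglyMeasurable) hgm.aestronglyMeasurable hlim).exists_seq_tendsto_ae
  refine entropicEnergy_le_of_tendsto_ae G ε (α := fun n => α (ns n)) (fun n => hac _) hgm hae ?_
  have hI2 : Tendsto (fun n => I + ENNReal.ofReal (ε * t (ns n) ^ 2)) atTop (𝓝 I) := by
    have h1 : Tendsto t atTop (𝓝 0) :=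
      tendsto_pow_atTop_nhds_zero_of_lt_one (by norm_num) (by norm_num)
    have h2 := ENNReal.tendsto_ofReal (((h1.comp hns.tendsto_atTop).pow 2).const_mul ε)
    simpa using h2.const_add I
  rw [← hI2.liminf_eq]
  exact liminf_le_liminf (Eventually.of_forall fun n => (hαI _).le)

end Entropic

/-! ### Convexity, closedness and nonemptiness of the constraint sets -/

section Constraints

variable {X : Type*} [MeasurableSpace X]

lemma measurableSet_extBall (r : ℝ≥0) : MeasurableSet (extBall X r) :=
  measurableSet_le measurable_snd measurable_const

lemma homMarginal_apply (p : ℝ) (β : Measure (Ext X)) {A : Set X} (hA : MeasurableSet A) :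
    homMarginal p β A =
      ∫⁻ y, (Prod.fst ⁻¹' A).indicator (fun y => ((y.2 ^ p : ℝ≥0) : ℝ≥0∞)) y ∂β := by
  rw [homMarginal, Measure.map_apply measurable_fst hA,
    withDensity_apply _ (measurable_fst hA), lintegral_indicator (measurable_fst hA)]

lemma homMarginal₀_eq (p : ℝ) (α : Measure (Ext X × Ext X)) :
    homMarginal₀ p α = homMarginal p (α.map Prod.fst) := by
  ext A hA
  rw [homMarginal_apply p _ hA, homMarginal₀, Measure.map_apply (by fun_prop) hA,
    withDensity_apply _ (hA.preimage (by fun_prop)), lintegral_map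
      ((by fun_prop : Measurable _).indicator (measurable_fst hA)) measurable_fst,
    ← lintegral_indicator (hA.preimage (by fun_prop))]
  rfl

lemma homMarginal₁_eq (p : ℝ) (α : Measure (Ext X × Ext X)) :
    homMarginal₁ p α = homMarginal p (α.map Prod.snd) := by
  ext A hA
  rw [homMarginal_apply p _ hA, homMarginal₁, Measure.map_apply (by fun_prop) hA,
    withDensity_apply _ (hA.preimage (by fun_prop)), lintegral_map
      ((by fun_prop : Measurable _).indicator (measurable_fst hA)) measurable_snd,
    ← lintegral_indicator (hA.preimage (by fun_prop))]
  rfl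

/-- Membership in the constraint set depends on the marginals only. -/
lemma mem_constraintSet_iff {p : ℝ} {μ₀ μ₁ : Measure X} {α : Measure (Ext X × Ext X)} :
    α ∈ constraintSet p μ₀ μ₁ ↔
      α.map Prod.fst ∈ constraintSetOne p (sStar p μ₀ μ₁) μ₀ ∧
      α.map Prod.snd ∈ constraintSetOne p (sStar p μ₀ μ₁) μ₁ := by
  have hB := (measurableSet_extBall (X := X) (sStar p μ₀ μ₁)).compl
  have hprob : IsProbabilityMeasure (α.map Prod.fst) ↔ IsProbabilityMeasure α :=
    Measure.isProbabilityMeasure_map_iff measurable_fst.aemeasurable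
  have hprob' : IsProbabilityMeasure (α.map Prod.snd) ↔ IsProbabilityMeasure α :=
    Measure.isProbabilityMeasure_map_iff measurable_snd.aemeasurable
  simp only [constraintSet, constraintSetOne, Set.mem_ofPred_eq, homMarginal₀_eq, homMarginal₁_eq,
    Measure.map_apply measurable_fst hB, Measure.map_apply measurable_snd hB, hprob, hprob',
    Set.compl_prod_eq_union, measure_union_null_iff, ← Set.prod_univ, ← Set.univ_prod]
  tauto

lemma map_smul_add {Ω Ω' : Type*} [MeasurableSpace Ω] [MeasurableSpace Ω'] {f : Ω → Ω'}
    (hf : Measurable f) (r : ℝ≥0∞) (α β : Measure Ω) :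
    (r • (α + β)).map f = r • (α.map f + β.map f) := by
  rw [Measure.map_smul, Measure.map_add _ _ hf]

lemma midpoint_mem_constraintSetOne {p : ℝ} {r : ℝ≥0} {μ : Measure X} {α β : Measure (Ext X)}
    (hα : α ∈ constraintSetOne p r μ) (hβ : β ∈ constraintSetOne p r μ) :
    (2⁻¹ : ℝ≥0∞) • (α + β) ∈ constraintSetOne p r μ := by
  obtain ⟨_, hα1, hα2⟩ := hα
  obtain ⟨_, hβ1, hβ2⟩ := hβ
  have h2 : (2⁻¹ : ℝ≥0∞) * 2 = 1 := ENNReal.inv_mul_cancel (by simp) (by simp)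
  refine ⟨⟨by simp [ENNReal.inv_two_add_inv_two]⟩, ?_, by simp [hα2, hβ2]⟩
  ext A hA
  rw [homMarginal_apply p _ hA, lintegral_smul_measure, lintegral_add_measure,
    ← homMarginal_apply p _ hA, ← homMarginal_apply p _ hA, hα1, hβ1, ← two_mul, smul_eq_mul,
    ← mul_assoc, h2, one_mul]

/-- On measures that do not charge the complement of `Y[r]`, the weight `s ^ p` may be truncated. -/
lemma homMarginal_apply_of_extBall {p : ℝ} {r : ℝ≥0} {β : Measure (Ext X)}
    (hβ : β (extBall X r)ᶜ = 0) {A : Set X} (hA : MeasurableSet A) :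
    homMarginal p β A =
      ∫⁻ y, (Prod.fst ⁻¹' A).indicator (fun y => (((min y.2 r) ^ p : ℝ≥0) : ℝ≥0∞)) y ∂β := by
  rw [homMarginal_apply p _ hA]
  refine lintegral_congr_ae ?_
  filter_upwards [mem_ae_iff.2 hβ] with y hy
  simp only [Set.indicator, min_eq_left (show y.2 ≤ r from hy)]

/-- Support and mass are tested with bounded functions at once. The weight `s ^ p` is unbounded, so
the support condition comes first and allows its truncation at `r`. -/
lemma constraintSetOne_closed {p : ℝ} (hp : 0 < p) {r : ℝ≥0} {μ : Measure X}
    (α : ℕ → Measure (Ext X)) (β : Measure (Ext X)) (hα : ∀ n, α n ∈ constraintSetOne p r μ)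
    (h : ∀ φ : Ext X → ℝ≥0∞, Measurable φ → ∀ M : ℝ≥0∞, M ≠ ∞ → (∀ x, φ x ≤ M) → ∀ v : ℝ≥0∞,
        (∀ n, ∫⁻ x, φ x ∂(α n) = v) → ∫⁻ x, φ x ∂β = v) :
    β ∈ constraintSetOne p r μ := by
  have hB := (measurableSet_extBall (X := X) r).compl
  have hβ : β (extBall X r)ᶜ = 0 := by
    rw [← lintegral_indicator_one hB]
    refine h _ (measurable_one.indicator hB) 1 (by simp)
      (fun x => Set.indicator_le_self' (by simp) x) 0 fun n => ?_
    rw [lintegral_indicator_one hB, (hα n).2.2]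
  refine ⟨⟨?_⟩, ?_, hβ⟩
  · rw [← lintegral_one]
    refine h _ measurable_const 1 (by simp) (by simp) 1 fun n => ?_
    have := (hα n).1
    simp
  · ext A hA
    rw [homMarginal_apply_of_extBall hβ hA]
    refine h _ (Measurable.indicator (by fun_prop) (measurable_fst hA)) ((r ^ p : ℝ≥0) : ℝ≥0∞)
      (by simp) (fun x => ?_) _ fun n => ?_
    · refine (Set.indicator_le_self _ _ x).trans (ENNReal.coe_le_coe.2 ?_)
      exact NNReal.rpow_le_rpow (min_le_right _ _) hp.le
    · rw [← homMarginal_apply_of_extBall (hα n).2.2 hA, (hα n).2.1]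

lemma constraintSet_closed {p : ℝ} (hp : 0 < p) {μ₀ μ₁ : Measure X}
    (α : ℕ → Measure (Ext X × Ext X)) (β : Measure (Ext X × Ext X))
    (hα : ∀ n, α n ∈ constraintSet p μ₀ μ₁)
    (h : ∀ φ : Ext X × Ext X → ℝ≥0∞, Measurable φ → ∀ M : ℝ≥0∞, M ≠ ∞ → (∀ x, φ x ≤ M) →
      ∀ v : ℝ≥0∞, (∀ n, ∫⁻ x, φ x ∂(α n) = v) → ∫⁻ x, φ x ∂β = v) :
    β ∈ constraintSet p μ₀ μ₁ := by
  simp only [mem_constraintSet_iff] at hα ⊢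
  refine ⟨constraintSetOne_closed hp _ _ (fun n => (hα n).1) ?_,
    constraintSetOne_closed hp _ _ (fun n => (hα n).2) ?_⟩
  · intro φ hφ M hM hφM v hv
    simp only [lintegral_map hφ measurable_fst] at hv ⊢
    exact h _ (hφ.comp measurable_fst) M hM (fun x => hφM _) v hv
  · intro φ hφ M hM hφM v hv
    simp only [lintegral_map hφ measurable_snd] at hv ⊢
    exact h _ (hφ.comp measurable_snd) M hM (fun x => hφM _) v hv

lemma homMarginal_add (p : ℝ) (α β : Measure (Ext X)) :
    homMarginal p (α + β) = homMarginal p α + homMarginal p β := by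
  ext A hA
  simp only [Measure.add_apply, homMarginal_apply p _ hA, lintegral_add_measure]

lemma homMarginal_smul (p : ℝ) (r : ℝ≥0∞) (α : Measure (Ext X)) :
    homMarginal p (r • α) = r • homMarginal p α := by
  ext A hA
  simp only [Measure.smul_apply, homMarginal_apply p _ hA, lintegral_smul_measure]

/-- The homogeneous marginal of a measure carried by the slice `{s = r}`. -/
lemma homMarginal_map_prodMk (p : ℝ) (r : ℝ≥0) (μ : Measure X) :
    homMarginal p (μ.map fun x => (x, r)) = ((r ^ p : ℝ≥0) : ℝ≥0∞) • μ := by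
  ext A hA
  rw [homMarginal_apply p _ hA, lintegral_map
    ((by fun_prop : Measurable _).indicator (measurable_fst hA)) (by fun_prop),
    Measure.smul_apply, smul_eq_mul, ← lintegral_indicator_const hA]
  rfl

/-- A measure rescaled onto the slice `{s = r}`, the remaining mass being put at height zero. -/
lemma smul_mem_constraintSetOne {p : ℝ} (hp : 0 < p) {r : ℝ≥0} {m : ℝ≥0∞} (hm0 : m ≠ 0)
    (hm : m ≠ ∞) (hr : ((r ^ p : ℝ≥0) : ℝ≥0∞) = m) {μ μ' : Measure X}
    (h : μ Set.univ + μ' Set.univ = m) :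
    m⁻¹ • ((μ.map fun x => (x, r)) + (μ'.map fun x => (x, (0 : ℝ≥0)))) ∈ constraintSetOne p r μ := by
  have hB := (measurableSet_extBall (X := X) r).compl
  have hmm : m⁻¹ * m = 1 := ENNReal.inv_mul_cancel hm0 hm
  refine ⟨⟨?_⟩, ?_, ?_⟩
  · rw [Measure.smul_apply, Measure.add_apply, Measure.map_apply (by fun_prop) .univ,
      Measure.map_apply (by fun_prop) .univ, Set.preimage_univ, Set.preimage_univ, h,
      smul_eq_mul, hmm]
  · rw [homMarginal_smul, homMarginal_add, homMarginal_map_prodMk, homMarginal_map_prodMk, hr,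
      NNReal.zero_rpow hp.ne', ENNReal.coe_zero, zero_smul, add_zero, smul_smul, hmm, one_smul]
  · rw [Measure.smul_apply, Measure.add_apply, Measure.map_apply (by fun_prop) hB,
      Measure.map_apply (by fun_prop) hB]
    simp [extBall]

/-- The product of two marginal competitors is admissible. For positive total mass `m`, `s_* ^ p =
m` cancels the normalisation `m⁻¹`, and the other measure, placed at height zero, fills up the mass
without affecting the homogeneous marginal. -/
lemma constraintSet_nonempty [Nonempty X] {p : ℝ} (hp : 0 < p) (μ₀ μ₁ : Measure X)
    [IsFiniteMeasure μ₀] [IsFiniteMeasure μ₁] : (constraintSet p μ₀ μ₁).Nonempty := by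
  suffices h : ∃ β₀ ∈ constraintSetOne p (sStar p μ₀ μ₁) μ₀,
      ∃ β₁ ∈ constraintSetOne p (sStar p μ₀ μ₁) μ₁, True by
    obtain ⟨β₀, h₀, β₁, h₁, -⟩ := h
    have := h₀.1
    have := h₁.1
    refine ⟨β₀.prod β₁, mem_constraintSet_iff.2 ⟨?_, ?_⟩⟩
    · simpa using h₀
    · simpa using h₁
  have hr : ((sStar p μ₀ μ₁ ^ p : ℝ≥0) : ℝ≥0∞) = μ₀ Set.univ + μ₁ Set.univ := by
    rw [sStar, ← NNReal.rpow_mul, one_div_mul_cancel hp.ne', NNReal.rpow_one, ENNReal.coe_add,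
      ENNReal.coe_toNNReal (measure_ne_top _ _), ENNReal.coe_toNNReal (measure_ne_top _ _)]
  -- When the total mass is zero there is nothing to normalise; a Dirac mass at height zero serves
  -- instead.
  rcases eq_or_ne (μ₀ Set.univ + μ₁ Set.univ) 0 with h0 | h0
  · obtain ⟨h1, h2⟩ := add_eq_zero.1 h0
    obtain ⟨x⟩ := ‹Nonempty X›
    have hμ₀ : μ₀ = 0 := Measure.measure_univ_eq_zero.1 h1
    have hμ₁ : μ₁ = 0 := Measure.measure_univ_eq_zero.1 h2
    have hmem : ∀ r, (Measure.dirac x).map (fun x => (x, (0 : ℝ≥0))) ∈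
        constraintSetOne p r (0 : Measure X) := fun r => by
      refine ⟨Measure.isProbabilityMeasure_map (by fun_prop), ?_, ?_⟩
      · rw [homMarginal_map_prodMk, NNReal.zero_rpow hp.ne', ENNReal.coe_zero, zero_smul]
      · rw [Measure.map_apply (by fun_prop) (measurableSet_extBall r).compl]
        simp [extBall]
    subst hμ₀ hμ₁
    exact ⟨_, hmem _, _, hmem _, trivial⟩
  · have hm : μ₀ Set.univ + μ₁ Set.univ ≠ ∞ := by simp
    exact ⟨_, smul_mem_constraintSetOne hp h0 hm hr rfl,
      _, smul_mem_constraintSetOne hp h0 hm hr (add_comm _ _), trivial⟩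

end Constraints

end EUOT

theorem mainTheorem7 {X : Type*} [MetricSpace X] [CompleteSpace X]
    [TopologicalSpace.SeparableSpace X] [MeasurableSpace X] [BorelSpace X]
    (F : ℝ≥0 → ℝ≥0∞) (hF : EUOT.IsEntropyFunction F)
    (c : X × X → ℝ≥0∞) (hc : LowerSemicontinuous c)
    (p : ℝ) (hp : 0 < p)
    (μ₀ μ₁ : Measure X) [IsFiniteMeasure μ₀] [IsFiniteMeasure μ₁]
    (ν : Measure (EUOT.Ext X × EUOT.Ext X)) [IsProbabilityMeasure ν]
    (ε : ℝ) (hε : 0 < ε) :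
    ∃ α ∈ EUOT.constraintSet p μ₀ μ₁,
      EUOT.UOTY F c p ε ν μ₀ μ₁ = EUOT.energy F c p ε ν α ∧
      EUOT.energy F c p ε ν α = EUOT.OTeps F c p ε ν (α.map Prod.fst) (α.map Prod.snd) ∧
      α.map Prod.fst ∈ EUOT.constraintSetOne p (EUOT.sStar p μ₀ μ₁) μ₀ ∧
      α.map Prod.snd ∈ EUOT.constraintSetOne p (EUOT.sStar p μ₀ μ₁) μ₁ := by
  -- The zero-mass case needs a point of `X`, which the probability measure `ν` provides.
  have : Nonempty X := by
    obtain ⟨y⟩ : Nonempty (EUOT.Ext X × EUOT.Ext X) := nonempty_of_isProbabilityMeasure ν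
    exact ⟨y.1.1⟩
  obtain ⟨α, hα, hmin⟩ := EUOT.exists_forall_entropicEnergy_le (EUOT.Hp F c p) hε ν
    (EUOT.constraintSet_nonempty hp μ₀ μ₁) (fun α h => h.1)
    (fun α hα β hβ => by
      rw [EUOT.mem_constraintSet_iff] at hα hβ ⊢
      rw [EUOT.map_smul_add measurable_fst, EUOT.map_smul_add measurable_snd]
      exact ⟨EUOT.midpoint_mem_constraintSetOne hα.1 hβ.1,
        EUOT.midpoint_mem_constraintSetOne hα.2 hβ.2⟩)
    (EUOT.constraintSet_closed hp)
  have hmarg := EUOT.mem_constraintSet_iff.1 hα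
  refine ⟨α, hα, le_antisymm (iInf₂_le α hα) (le_iInf₂ hmin), le_antisymm ?_ ?_, hmarg⟩
  -- A coupling `β` has the marginals of `α`, hence satisfies the same constraints and cannot have
  -- smaller energy.
  · refine le_iInf₂ fun β hβ => hmin β (EUOT.mem_constraintSet_iff.2 ?_)
    rw [hβ.2.1, hβ.2.2]
    exact hmarg
  · exact iInf₂_le α ⟨hα.1, rfl, rfl⟩
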